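/- Let $D$ be any virtual link diagram with $\mu\ge 0$ components, i.e. $\mu$ oriented circles generically immersed in the plane (the only self-intersections are transverse double points), each double point being designated as virtual, or as classical with one of its two strands overpassing. Cutting the circles at the underpassing points of the classical crossings yields the set $A(D)$ of arcs; let $C(D)$ be the set of classical crossings. For $c\in C(D)$ let $a(c)$ be the overpassing arc at $c$, and let $b_1(c)$ and $b_2(c)$ be the underpassing arcs at $c$ on the right and on the left of $a(c)$, respectively. For $a\in A(D)$ let $\kappa(a)\in\{1,\dots,\mu\}$ be the index of the component containing $a$. Let $L$ be the link represented by $D$. The fundamental quandle $Q(L)$ is the quandle with generators $q_a$ $(a\in A(D))$ and relations $q_{b_1(c)}\triangleright q_{a(c)}=q_{b_2(c)}$ $(c\in C(D))$. The link group $G(L)$ is the group with generators $g_a$ $(a\in A(D))$ and relations $g_{a(c)}g_{b_1(c)}g_{a(c)}^{-1}g_{b_2(c)}^{-1}=1$ $(c\in C(D))$. For a group $G$, $\mathrm{Conj}(G)$ is the set $G$ with the quandle operation $x\triangleright y=yxy^{-1}$. The natural image of $Q(L)$ in $G(L)/G(L)''$ is the image of the quandle homomorphism $Q(L)\to\mathrm{Conj}(G(L)/G(L)'')$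 with $q_a\mapsto g_aG(L)''$ for all $a \in A(D)$, where $G(L)''$ is the second derived subgroup. Let $\Lambda_\mu=\mathbb Z[t_1^{\pm1},\dots,t_\mu^{\pm1}]$. The Alexander module $M_A(L)$ is the quotient of the free $\Lambda_\mu$-module on $A(D)$ by the submodule generated by the elements \[(1-t_{\kappa(b_1(c))})\,a(c)+t_{\kappa(a(c))}\,b_1(c)-b_2(c),\qquad c\in C(D);\] the image of $a\in A(D)$ in $M_A(L)$ is denoted $\gamma_D(a)$. Let $I_\mu$ be the ideal of $\Lambda_\mu$ generated by $t_1-1,\dots,t_\mu-1$, and let $\phi_L:M_A(L)\to I_\mu$ be the $\Lambda_\mu$-linear map with $\phi_L(\gamma_D(a))=t_{\kappa(a)}-1$ for all $a\in A(D)$. The total multivariate Alexander quandle is \[U(L)=\{x\in M_A(L)\mid \phi_L(x)+1\text{ is a unit of }\Lambda_\mu\},\qquad x\triangleright y=(\phi_L(y)+1)x-\phi_L(x)y,\] and the fundamental multivariate Alexander quandle $Q_A(L)$ is the subquandle of $U(L)$ generated by $\{\gamma_D(a)\mid a\in A(D)\}$. Theorem. The quandle $U(L)$ is isomorphic to $\mathrm{Conj}(G(L)/G(L)'')$.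 Moreover, there is a quandle isomorphism $U(L)\to\mathrm{Conj}(G(L)/G(L)'')$ that maps $Q_A(L)$ onto the natural image of $Q(L)$ in $G(L)/G(L)''$. -/

import Mathlib

open scoped Quandles Topology

noncomputable section

/-! ### Quandles: presentations and generated subquandles

The operation `x ▷ y` (with `y` acting on `x`) is written `y ◃ x` in Mathlib's left-handed
convention. In particular `x ▷ y = y * x * y⁻¹` in `Quandle.Conj G`. -/

/-- Formal words in the two quandle operations on a set `A` of generators. -/
inductive QuandleWord (A : Type*) where
  | of : A → QuandleWord A
  | act : QuandleWord A → QuandleWord A → QuandleWord A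
  | invAct : QuandleWord A → QuandleWord A → QuandleWord A

/-- The smallest congruence on quandle words that contains `rels` and forces the quandle axioms. -/
inductive QuandleCongr {A : Type*} (rels : QuandleWord A → QuandleWord A → Prop) :
    QuandleWord A → QuandleWord A → Prop where
  | rel {x y} : rels x y → QuandleCongr rels x y
  | refl (x) : QuandleCongr rels x x
  | symm {x y} : QuandleCongr rels x y → QuandleCongr rels y x
  | trans {x y z} : QuandleCongr rels x y → QuandleCongr rels y z → QuandleCongr rels x z
  | act {x x' y y'} : QuandleCongr rels x x' → QuandleCongr rels y y' →
      QuandleCongr rels (.act x y) (.act x' y')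
  | invAct {x x' y y'} : QuandleCongr rels x x' → QuandleCongr rels y y' →
      QuandleCongr rels (.invAct x y) (.invAct x' y')
  | self_distrib (x y z) :
      QuandleCongr rels (.act x (.act y z)) (.act (.act x y) (.act x z))
  | left_inv (x y) : QuandleCongr rels (.invAct x (.act x y)) y
  | right_inv (x y) : QuandleCongr rels (.act x (.invAct x y)) y
  | fix (x) : QuandleCongr rels (.act x x) x

/-- The congruence as a setoid. -/
def quandleSetoid {A : Type*} (rels : QuandleWord A → QuandleWord A → Prop) :
    Setoid (QuandleWord A) where
  r := QuandleCongr rels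
  iseqv := ⟨.refl, .symm, .trans⟩

/-- The quandle presented by the generators `A` and the relations `rels`. -/
def PresentedQuandle {A : Type*} (rels : QuandleWord A → QuandleWord A → Prop) :=
  Quotient (quandleSetoid rels)

namespace PresentedQuandle

variable {A : Type*} {rels : QuandleWord A → QuandleWord A → Prop}

/-- The element of the presented quandle represented by a generator. -/
def of (a : A) : PresentedQuandle rels := Quotient.mk (quandleSetoid rels) (.of a)

instance : Quandle (PresentedQuandle rels) where
  act := Quotient.map₂ QuandleWord.act fun _ _ h _ _ h' => QuandleCongr.act h h'
  self_distrib := by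
    rintro ⟨x⟩ ⟨y⟩ ⟨z⟩
    exact Quotient.sound (QuandleCongr.self_distrib x y z)
  invAct := Quotient.map₂ QuandleWord.invAct fun _ _ h _ _ h' => QuandleCongr.invAct h h'
  left_inv := by
    rintro ⟨x⟩ ⟨y⟩
    exact Quotient.sound (QuandleCongr.left_inv x y)
  right_inv := by
    rintro ⟨x⟩ ⟨y⟩
    exact Quotient.sound (QuandleCongr.right_inv x y)
  fix := by
    rintro ⟨x⟩
    exact Quotient.sound (QuandleCongr.fix x)

/-- The value of a quandle word under an assignment of its generators. -/
def eval {R : Type*} [Quandle R] (f : A → R) : QuandleWord A → R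
  | .of a => f a
  | .act x y => eval f x ◃ eval f y
  | .invAct x y => eval f x ◃⁻¹ eval f y

theorem eval_congr {R : Type*} [Quandle R] (f : A → R)
    (hf : ∀ x y, rels x y → eval f x = eval f y) {x y : QuandleWord A}
    (h : QuandleCongr rels x y) : eval f x = eval f y := by
  induction h with
  | rel h => exact hf _ _ h
  | refl => rfl
  | symm _ ih => exact ih.symm
  | trans _ _ ih ih' => exact ih.trans ih'
  | act _ _ ih ih' => simp only [eval, ih, ih']
  | invAct _ _ ih ih' => simp only [eval, ih, ih']
  | self_distrib => exact Shelf.self_distrib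
  | left_inv x y => exact Rack.left_inv _ _
  | right_inv x y => exact Rack.right_inv _ _
  | fix => exact Quandle.fix

/-- The homomorphism out of a presented quandle determined by the images of the generators. -/
def lift {R : Type*} [Quandle R] (f : A → R)
    (hf : ∀ x y, rels x y → eval f x = eval f y) : PresentedQuandle rels →◃ R where
  toFun := Quotient.lift (eval f) fun _ _ h => eval_congr f hf h
  map_act' := by
    rintro ⟨x⟩ ⟨y⟩
    rfl

end PresentedQuandle

/-- The subquandle generated by a subset `S` of a quandle. -/
inductive QuandleClosure {R : Type*} [Quandle R] (S : Set R) : R → Prop where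
  | mem {x} : x ∈ S → QuandleClosure S x
  | act {x y} : QuandleClosure S x → QuandleClosure S y → QuandleClosure S (x ◃ y)
  | invAct {x y} : QuandleClosure S x → QuandleClosure S y → QuandleClosure S (x ◃⁻¹ y)

/-! ### Virtual link diagrams -/

/-- The disjoint union of `μ` oriented circles. -/
abbrev Circles (μ : ℕ) := Fin μ × UnitAddCircle

/-- The determinant of two vectors of the oriented plane. It is positive exactly when `w` points
to the left of `v`. -/
def planeDet (v w : ℝ × ℝ) : ℝ := v.1 * w.2 - v.2 * w.1

/-- The velocity of a map from the circles to the plane, at a point of one of the circles. -/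
def velocity {μ : ℕ} (pos : Circles μ → ℝ × ℝ) (p : Circles μ) : ℝ × ℝ :=
  deriv (fun s : ℝ => pos (p.1, p.2 + (s : UnitAddCircle))) 0

/-- A virtual link diagram with `μ` components: `μ` oriented circles generically immersed in the
plane, some of whose double points are declared to be classical crossings. The double points that
are not declared to be classical are the virtual crossings. -/
structure VirtualLinkDiagram (μ : ℕ) where
  /-- the immersion -/
  pos : Circles μ → ℝ × ℝ
  contDiff : ∀ i, ContDiff ℝ 1 (fun s : ℝ => pos (i, (s : UnitAddCircle)))
  immersed : ∀ p, velocity pos p ≠ 0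
  transverse : ∀ p q, p ≠ q → pos p = pos q → planeDet (velocity pos p) (velocity pos q) ≠ 0
  no_triple : ∀ p q r, pos p = pos q → pos q = pos r → p = q ∨ q = r ∨ p = r
  /-- the classical crossings, each given as the pair of its overpassing and its underpassing
  point -/
  crossings : Finset (Circles μ × Circles μ)
  crossing_ne : ∀ c ∈ crossings, c.1 ≠ c.2
  crossing_pos : ∀ c ∈ crossings, pos c.1 = pos c.2
  /-- the two points over a classical crossing are not both overpassing -/
  crossing_asymm : ∀ c ∈ crossings, c.swap ∉ crossings

namespace VirtualLinkDiagram

variable {μ : ℕ} (D : VirtualLinkDiagram μ)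

/-- The set `C(D)` of classical crossings. -/
abbrev Crossing := {c : Circles μ × Circles μ // c ∈ D.crossings}

/-- The underpassing points, where the circles are cut. -/
def underPoints : Set (Circles μ) := Prod.snd '' (D.crossings : Set (Circles μ × Circles μ))

/-- The circles with the underpassing points removed. -/
abbrev Cut := {p : Circles μ // p ∉ D.underPoints}

/-- The set `A(D)` of arcs: the pieces into which the circles are cut. -/
abbrev Arc := ConnectedComponents D.Cut

theorem continuous_component : Continuous (fun p : D.Cut => p.1.1) :=
  continuous_fst.comp continuous_subtype_val

/-- `κ_D(a)`, the index of the component to which an arc belongs. -/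
def component : D.Arc → Fin μ := D.continuous_component.connectedComponentsLift

theorem over_not_mem_underPoints (c : D.Crossing) : c.1.1 ∉ D.underPoints := by
  obtain ⟨⟨p, q⟩, hc⟩ := c
  rintro ⟨⟨r, p'⟩, hc', h⟩
  have hc' : (r, p') ∈ D.crossings := hc'
  obtain rfl : p' = p := h
  have h1 := D.crossing_ne _ hc
  have h2 := D.crossing_ne _ hc'
  have h3 := D.crossing_asymm _ hc
  rcases D.no_triple r p' q (D.crossing_pos _ hc') (D.crossing_pos _ hc) with h | h | h
  · exact h2 h
  · exact h1 h
  · subst h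
    exact h3 hc'

/-- `a(c)`, the overpassing arc at a crossing. -/
def overArc (c : D.Crossing) : D.Arc :=
  ConnectedComponents.mk ⟨c.1.1, D.over_not_mem_underPoints c⟩

/-- The points `p + s` of the circles lie on the arc `a`, for all `s` near `0` in the filter `l`. -/
def GermOn (l : Filter ℝ) (p : Circles μ) (a : D.Arc) : Prop :=
  ∀ᶠ s : ℝ in l, ∃ h : (p.1, p.2 + (s : UnitAddCircle)) ∉ D.underPoints,
    (ConnectedComponents.mk ⟨_, h⟩ : D.Arc) = a

theorem exists_radius (p : Circles μ) : ∃ ε : ℝ, 0 < ε ∧ ∀ s : ℝ, s ≠ 0 → |s| < ε →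
    (p.1, p.2 + (s : UnitAddCircle)) ∉ D.underPoints := by
  have hfin : (D.underPoints \ {p}).Finite := (D.crossings.finite_toSet.image _).subset
    Set.sdiff_subset
  have hc : Continuous (fun s : ℝ => ((p.1, p.2 + (s : UnitAddCircle)) : Circles μ)) :=
    continuous_const.prodMk (continuous_const.add (AddCircle.continuous_mk' 1))
  have hopen := hfin.isClosed.isOpen_compl.preimage hc
  obtain ⟨ε, hε, hball⟩ := Metric.isOpen_iff.1 hopen 0 (by simp)
  refine ⟨min ε 1, lt_min hε one_pos, fun s hs0 hs hmem => ?_⟩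
  have h1 := hball (show s ∈ Metric.ball (0 : ℝ) ε by
    simpa using hs.trans_le (min_le_left _ _))
  refine h1 ⟨hmem, fun heq => hs0 ?_⟩
  have h2 : p.2 + (s : UnitAddCircle) = p.2 := congrArg Prod.snd heq
  have h3 : (s : UnitAddCircle) = 0 := by simpa using h2
  obtain ⟨n, hn⟩ := (AddCircle.coe_eq_zero_iff (1 : ℝ)).1 h3
  have h4 : |s| < 1 := hs.trans_le (min_le_right _ _)
  have h5 : (n : ℝ) = s := by simpa using hn
  rw [← h5] at h4
  have h6 : |n| < 1 := by exact_mod_cast h4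
  rw [← h5, Int.abs_lt_one_iff.1 h6, Int.cast_zero]

theorem exists_arc_of_Ioo (p : Circles μ) {u v : ℝ} (huv : u < v)
    (h : ∀ s ∈ Set.Ioo u v, (p.1, p.2 + (s : UnitAddCircle)) ∉ D.underPoints) :
    ∃ a : D.Arc, ∀ s (hs : s ∈ Set.Ioo u v), ConnectedComponents.mk ⟨_, h s hs⟩ = a := by
  have hc : Continuous (fun s : ℝ => ((p.1, p.2 + (s : UnitAddCircle)) : Circles μ)) :=
    continuous_const.prodMk (continuous_const.add (AddCircle.continuous_mk' 1))
  let g : Set.Ioo u v → D.Arc := fun s => ConnectedComponents.mk ⟨_, h s.1 s.2⟩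
  have hg : Continuous g := ConnectedComponents.continuous_coe.comp
    ((hc.comp continuous_subtype_val).subtype_mk _)
  have : PreconnectedSpace (Set.Ioo u v) := Subtype.preconnectedSpace isPreconnected_Ioo
  obtain ⟨m, hm⟩ := exists_between huv
  exact ⟨g ⟨m, hm⟩, fun s hs => (isPreconnected_univ.image g hg.continuousOn).subsingleton
    (Set.mem_image_of_mem g (Set.mem_univ ⟨s, hs⟩))
    (Set.mem_image_of_mem g (Set.mem_univ ⟨m, hm⟩))⟩

theorem exists_arcBefore (p : Circles μ) : ∃ a, D.GermOn (𝓝[<] 0) p a := by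
  obtain ⟨ε, hε, h⟩ := D.exists_radius p
  have h' : ∀ s ∈ Set.Ioo (-ε) 0, (p.1, p.2 + (s : UnitAddCircle)) ∉ D.underPoints :=
    fun s hs => h s hs.2.ne (abs_lt.2 ⟨hs.1, hs.2.trans hε⟩)
  obtain ⟨a, ha⟩ := D.exists_arc_of_Ioo p (neg_lt_zero.2 hε) h'
  exact ⟨a, Filter.mem_of_superset (Ioo_mem_nhdsLT (neg_lt_zero.2 hε))
    fun s hs => ⟨h' s hs, ha s hs⟩⟩

theorem exists_arcAfter (p : Circles μ) : ∃ a, D.GermOn (𝓝[>] 0) p a := by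
  obtain ⟨ε, hε, h⟩ := D.exists_radius p
  have h' : ∀ s ∈ Set.Ioo 0 ε, (p.1, p.2 + (s : UnitAddCircle)) ∉ D.underPoints :=
    fun s hs => h s hs.1.ne' (abs_lt.2 ⟨(neg_lt_zero.2 hε).trans hs.1, hs.2⟩)
  obtain ⟨a, ha⟩ := D.exists_arc_of_Ioo p hε h'
  exact ⟨a, Filter.mem_of_superset (Ioo_mem_nhdsGT hε) fun s hs => ⟨h' s hs, ha s hs⟩⟩

/-- The arc that runs into the point `p`, with respect to the orientation. -/
def arcBefore (p : Circles μ) : D.Arc := (D.exists_arcBefore p).choose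

/-- The arc that leaves the point `p`, with respect to the orientation. -/
def arcAfter (p : Circles μ) : D.Arc := (D.exists_arcAfter p).choose

theorem component_of_germ {l : Filter ℝ} [l.NeBot] {p : Circles μ} {a : D.Arc}
    (h : D.GermOn l p a) : D.component a = p.1 := by
  obtain ⟨s, hs, rfl⟩ := h.exists
  rfl

theorem component_arcBefore (p : Circles μ) : D.component (D.arcBefore p) = p.1 :=
  D.component_of_germ (D.exists_arcBefore p).choose_spec

theorem component_arcAfter (p : Circles μ) : D.component (D.arcAfter p) = p.1 :=
  D.component_of_germ (D.exists_arcAfter p).choose_spec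

/-- The underpassing strand crosses the overpassing one from its right to its left. -/
def RightToLeft (c : D.Crossing) : Prop :=
  0 < planeDet (velocity D.pos c.1.1) (velocity D.pos c.1.2)

open Classical in
/-- `b₁(c)`, the underpassing arc on the right of the overpassing arc. -/
def rightArc (c : D.Crossing) : D.Arc :=
  if D.RightToLeft c then D.arcBefore c.1.2 else D.arcAfter c.1.2

open Classical in
/-- `b₂(c)`, the underpassing arc on the left of the overpassing arc. -/
def leftArc (c : D.Crossing) : D.Arc :=
  if D.RightToLeft c then D.arcAfter c.1.2 else D.arcBefore c.1.2

theorem component_rightArc (c : D.Crossing) :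
    D.component (D.rightArc c) = D.component (D.leftArc c) := by
  unfold rightArc leftArc
  split_ifs <;> rw [component_arcBefore, component_arcAfter]

/-! ### The link group and the fundamental quandle -/

/-- The relators `g_{a(c)} g_{b₁(c)} g_{a(c)}⁻¹ g_{b₂(c)}⁻¹`. -/
def groupRels : Set (FreeGroup D.Arc) :=
  Set.range fun c : D.Crossing => FreeGroup.of (D.overArc c) * FreeGroup.of (D.rightArc c) *
    (FreeGroup.of (D.overArc c))⁻¹ * (FreeGroup.of (D.leftArc c))⁻¹

/-- The group `G(L)`. -/
abbrev LinkGroup := PresentedGroup D.groupRels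

/-- The relations `q_{b₁(c)} ▷ q_{a(c)} = q_{b₂(c)}`. -/
inductive QuandleRel : QuandleWord D.Arc → QuandleWord D.Arc → Prop where
  | crossing (c : D.Crossing) :
      QuandleRel (.act (.of (D.overArc c)) (.of (D.rightArc c))) (.of (D.leftArc c))

/-- The fundamental quandle `Q(L)`. -/
abbrev FundamentalQuandle := PresentedQuandle D.QuandleRel

theorem group_relation (c : D.Crossing) :
    (PresentedGroup.of (D.overArc c) * PresentedGroup.of (D.rightArc c) *
      (PresentedGroup.of (D.overArc c))⁻¹ : D.LinkGroup) = PresentedGroup.of (D.leftArc c) := by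
  rw [← mul_inv_eq_one]
  exact PresentedGroup.one_of_mem ⟨c, rfl⟩

/-- The natural map `Q(L) → Conj G(L)`, `q_a ↦ g_a`. -/
def toConjGroup : D.FundamentalQuandle →◃ Quandle.Conj D.LinkGroup :=
  PresentedQuandle.lift (R := Quandle.Conj D.LinkGroup) (fun a => PresentedGroup.of a) (by
    rintro _ _ ⟨c⟩
    exact D.group_relation c)

/-- The metabelian quotient `G(L)/G(L)''`. -/
abbrev MetabelianQuotient := D.LinkGroup ⧸ derivedSeries D.LinkGroup 2

/-- The natural map `Q(L) → Conj (G(L)/G(L)'')`. -/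
def toConjMetabelian : D.FundamentalQuandle →◃ Quandle.Conj D.MetabelianQuotient :=
  (Quandle.Conj.map (QuotientGroup.mk' (derivedSeries D.LinkGroup 2))).comp D.toConjGroup

/-- The natural image of `Q(L)` in `G(L)/G(L)''`. -/
def naturalImage : Set (Quandle.Conj D.MetabelianQuotient) := Set.range D.toConjMetabelian

end VirtualLinkDiagram

/-! ### The Alexander module and its quandles -/

/-- The ring `Λ_μ` of integral Laurent polynomials in `μ` variables. -/
abbrev LaurentRing (μ : ℕ) := AddMonoidAlgebra ℤ (Fin μ →₀ ℤ)

/-- The variable `t_i`. -/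
def LaurentRing.t {μ : ℕ} (i : Fin μ) : LaurentRing μ :=
  AddMonoidAlgebra.single (Finsupp.single i 1) 1

/-- The augmentation ideal `I_μ`, generated by the elements `t_i - 1`. -/
def augmentationIdeal (μ : ℕ) : Ideal (LaurentRing μ) :=
  Ideal.span (Set.range fun i : Fin μ => LaurentRing.t i - 1)

namespace VirtualLinkDiagram

open LaurentRing

variable {μ : ℕ} (D : VirtualLinkDiagram μ)

/-- The map `ρ_D` from the free module on the crossings to the free module on the arcs. -/
def rho : (D.Crossing →₀ LaurentRing μ) →ₗ[LaurentRing μ] (D.Arc →₀ LaurentRing μ) :=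
  Finsupp.linearCombination (LaurentRing μ) fun c =>
    Finsupp.single (D.overArc c) (1 - t (D.component (D.rightArc c))) +
      Finsupp.single (D.rightArc c) (t (D.component (D.overArc c))) -
      Finsupp.single (D.leftArc c) 1

/-- The multivariate Alexander module `M_A(L)`, the cokernel of `ρ_D`. -/
abbrev AlexanderModule := (D.Arc →₀ LaurentRing μ) ⧸ LinearMap.range D.rho

/-- The element `γ_D(a)` of the Alexander module. -/
def gamma (a : D.Arc) : D.AlexanderModule :=
  Submodule.Quotient.mk (Finsupp.single a 1)

/-- The map `a ↦ t_{κ(a)} - 1` on the free module on the arcs. -/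
def crowellAux : (D.Arc →₀ LaurentRing μ) →ₗ[LaurentRing μ] augmentationIdeal μ :=
  Finsupp.linearCombination (LaurentRing μ) fun a =>
    (⟨t (D.component a) - 1, Ideal.subset_span ⟨_, rfl⟩⟩ : augmentationIdeal μ)

theorem crowellAux_rho : LinearMap.range D.rho ≤ LinearMap.ker D.crowellAux := by
  rw [LinearMap.range_le_ker_iff]
  ext c
  simp only [rho, crowellAux, LinearMap.comp_apply, Finsupp.lsingle_apply,
    Finsupp.linearCombination_single, one_smul, map_sub, map_add, LinearMap.zero_apply,
    Submodule.coe_sub, Submodule.coe_add, Submodule.coe_smul, smul_eq_mul, ZeroMemClass.coe_zero,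
    D.component_rightArc c]
  ring_nf

/-- The Crowell map `φ_L : M_A(L) → I_μ`, `γ_D(a) ↦ t_{κ(a)} - 1`. -/
def crowell : D.AlexanderModule →ₗ[LaurentRing μ] augmentationIdeal μ :=
  (LinearMap.range D.rho).liftQ D.crowellAux D.crowellAux_rho

/-- The Crowell map followed by the inclusion of `I_μ` in `Λ_μ`. -/
def phi : D.AlexanderModule →ₗ[LaurentRing μ] LaurentRing μ :=
  (augmentationIdeal μ).subtype ∘ₗ D.crowell

theorem phi_gamma (a : D.Arc) : D.phi (D.gamma a) = t (D.component a) - 1 := by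
  simp [phi, gamma, crowell, crowellAux]

/-- The set `U(L)` of all `x ∈ M_A(L)` such that `φ_L(x) + 1` is a unit of `Λ_μ`. -/
def TotalQuandle := {x : D.AlexanderModule // IsUnit (D.phi x + 1)}

theorem phi_act (x y : D.AlexanderModule) :
    D.phi ((D.phi y + 1) • x - D.phi x • y) = D.phi x := by
  simp only [map_sub, map_smul, smul_eq_mul]
  ring

theorem phi_invAct (x : D.AlexanderModule) (y : D.TotalQuandle) :
    D.phi ((↑y.2.unit⁻¹ : LaurentRing μ) • (x + D.phi x • y.1)) = D.phi x := by
  have h : (↑y.2.unit⁻¹ : LaurentRing μ) * (D.phi y.1 + 1) = 1 := y.2.val_inv_mul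
  simp only [map_add, map_smul, smul_eq_mul]
  linear_combination D.phi x * h

/-- The total multivariate Alexander quandle, with `x ▷ y = (φ(y) + 1) x - φ(x) y`. -/
instance : Quandle D.TotalQuandle where
  act y x := ⟨(D.phi y.1 + 1) • x.1 - D.phi x.1 • y.1, by rw [phi_act]; exact x.2⟩
  self_distrib := by
    intro x y z
    apply Subtype.ext
    simp only [phi_act]
    module
  invAct y x := ⟨(↑y.2.unit⁻¹ : LaurentRing μ) • (x.1 + D.phi x.1 • y.1), by
    rw [phi_invAct]; exact x.2⟩
  left_inv := by
    intro y x
    apply Subtype.ext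
    have h : (↑y.2.unit⁻¹ : LaurentRing μ) * (D.phi y.1 + 1) = 1 := y.2.val_inv_mul
    simp only [phi_act, sub_add_cancel, smul_smul, h, one_smul]
  right_inv := by
    intro y x
    apply Subtype.ext
    have h : (D.phi y.1 + 1) * (↑y.2.unit⁻¹ : LaurentRing μ) = 1 := y.2.mul_val_inv
    simp only [phi_invAct, smul_smul, h, one_smul, add_sub_cancel_right]
  fix := by
    intro x
    apply Subtype.ext
    simp only
    module

theorem isUnit_t (i : Fin μ) : IsUnit (t i : LaurentRing μ) := by
  refine IsUnit.of_mul_eq_one (AddMonoidAlgebra.single (-Finsupp.single i 1) 1) ?_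
  rw [t, AddMonoidAlgebra.single_mul_single, add_neg_cancel, one_mul]
  rfl

/-- `γ_D(a)` as an element of `U(L)`. -/
def gammaU (a : D.Arc) : D.TotalQuandle :=
  ⟨D.gamma a, by rw [phi_gamma, sub_add_cancel]; exact isUnit_t _⟩

/-- The fundamental multivariate Alexander quandle `Q_A(L)`, the subquandle of `U(L)` generated by
the elements `γ_D(a)`. -/
def fundamentalAlexanderQuandle : Set D.TotalQuandle :=
  {x | QuandleClosure (Set.range D.gammaU) x}

end VirtualLinkDiagram

end

/-! The set $U(L)$ is a group under $x*y=x+(\phi(x)+1)y$, and its quandle operation is conjugation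
in this group (`ofQuandle_act`). The assignment $g_a\mapsto\gamma_D(a)$ extends to a homomorphism
`fox` from $G$ to this group, so it suffices that `fox` is onto with kernel $G''$. An isomorphism of
groups is an isomorphism of their conjugation quandles, and it matches the generators $\gamma_D(a)$
and $g_aG''$.

The degree map $G\to\mathbb Z^\mu$ is the abelianization (`ker_degree`). Additively, `fox` obeys the
product rule $fox(gg')=fox(g)+t^{\deg g}fox(g')$, so it is additive on $G'$ and kills $G''$.
Conversely, the Schreier elements $s(h)\,g\,s(h+\deg g)^{-1}$ in $G'/G''$ obey the same rule, which
yields a map `foxInv` on the Alexander module that recovers $g$ from `fox g` modulo $G''$ when $g\in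
G'$ (`ker_fox`).

Surjectivity rests on two facts: the kernel of $\phi$ is contained in $fox(G')$ (`crowellInv_phi`),
and a unit in $1+I_\mu$ is a monomial with coefficient 1 (`exists_eq_monomial`), hence is attained
as $\phi+1$ at a value of `fox`. -/

noncomputable section

/-! ### Laurent polynomials -/

namespace AddMonoidAlgebra

/-- The additive map from an integral group ring determined by its values on the monomials. -/
def monomialLift {X N : Type*} [AddCommGroup N] (w : X → N) : AddMonoidAlgebra ℤ X →+ N :=
  (Finsupp.liftAddHom fun h => zmultiplesHom N (w h)).comp coeffAddEquiv.toAddMonoidHom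

theorem monomialLift_single {X N : Type*} [AddCommGroup N] (w : X → N) (h : X) (n : ℤ) :
    monomialLift w (single h n) = n • w h := by
  simp [monomialLift]

theorem addMonoidHom_ext_monomial {X N : Type*} [AddCommGroup N]
    {f g : AddMonoidAlgebra ℤ X →+ N} (h : ∀ x, f (single x 1) = g (single x 1)) : f = g := by
  refine addHom_ext' fun x => AddMonoidHom.ext_int ?_
  exact h x

/-- In an additive monoid with two unique sums, the units of the monoid algebra over a domain are
monomials. -/
theorem exists_eq_single_of_isUnit {R X : Type*} [CommRing R] [IsDomain R] [AddMonoid X]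
    [TwoUniqueSums X] {f : AddMonoidAlgebra R X} (hf : IsUnit f) :
    ∃ h r, f = single h r := by
  obtain ⟨g, hfg, -⟩ := isUnit_iff_exists.1 hf
  have hne : f * g ≠ 0 := by
    rw [hfg]
    intro h
    have := congrArg (fun p => p.coeff 0) h
    simp [one_def] at this
  have hf0 : f.coeff.support.Nonempty := by
    rw [Finsupp.support_nonempty_iff]
    intro h
    exact hne (by rw [show f = 0 from coeff_injective h, zero_mul])
  have hg0 : g.coeff.support.Nonempty := by
    rw [Finsupp.support_nonempty_iff]
    intro h
    exact hne (by rw [show g = 0 from coeff_injective h, mul_zero])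
  -- At a unique sum the coefficient of $fg=1$ is a product of nonzero scalars, so the exponent must
  -- be 0.
  have key : ∀ a ∈ f.coeff.support, ∀ b ∈ g.coeff.support,
      UniqueAdd f.coeff.support g.coeff.support a b → a + b = 0 := by
    intro a ha b hb hu
    by_contra hab
    have h1 := coeff_mul_add_of_uniqueAdd hu
    rw [hfg, one_def, coeff_single, Finsupp.single_eq_of_ne hab] at h1
    exact mul_ne_zero (Finsupp.mem_support_iff.1 ha) (Finsupp.mem_support_iff.1 hb) h1.symm
  -- Two distinct unique sums would both equal 0, contradicting the uniqueness of either.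
  have hcard : ¬ 1 < f.coeff.support.card * g.coeff.support.card := by
    intro hlt
    obtain ⟨p, hp, q, hq, hpq, hup, huq⟩ := TwoUniqueSums.uniqueAdd_of_one_lt_card hlt
    rw [Finset.mem_product] at hp hq
    have h := (key _ hp.1 _ hp.2 hup).trans (key _ hq.1 _ hq.2 huq).symm
    obtain ⟨h1, h2⟩ := huq hp.1 hp.2 h
    exact hpq (Prod.ext h1 h2)
  have h1 : f.coeff.support.card = 1 := by
    have := hf0.card_pos
    have := hg0.card_pos
    nlinarith
  obtain ⟨h, r, -, hfr⟩ := Finsupp.card_support_eq_one'.1 h1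
  exact ⟨h, r, coeff_injective hfr⟩

end AddMonoidAlgebra

namespace LaurentRing

open AddMonoidAlgebra

variable {μ : ℕ}

/-- The sum of the coefficients of a Laurent polynomial. -/
def augmentation (μ : ℕ) : LaurentRing μ →ₐ[ℤ] ℤ := AddMonoidAlgebra.lift ℤ ℤ (Fin μ →₀ ℤ) 1

theorem augmentation_single (h : Fin μ →₀ ℤ) (n : ℤ) : augmentation μ (single h n) = n := by
  simp [augmentation]

theorem augmentation_eq_zero {f : LaurentRing μ} (hf : f ∈ augmentationIdeal μ) :
    augmentation μ f = 0 := by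
  have h : augmentationIdeal μ ≤ RingHom.ker (augmentation μ) := by
    rw [augmentationIdeal, Ideal.span_le]
    rintro _ ⟨i, rfl⟩
    simp [RingHom.mem_ker, t, augmentation_single]
  exact h hf

/-- Augmentation kills $I_\mu$, so the coefficient of the monomial is 1; in particular the sign $-1$
is excluded. -/
theorem exists_eq_monomial {f : LaurentRing μ} (hf : f ∈ augmentationIdeal μ)
    (hu : IsUnit (f + 1)) : ∃ h, f + 1 = single h 1 := by
  obtain ⟨h, n, hn⟩ := exists_eq_single_of_isUnit hu
  have h1 := congrArg (augmentation μ) hn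
  rw [map_add, augmentation_eq_zero hf, map_one, augmentation_single, zero_add] at h1
  exact ⟨h, by rw [hn, h1]⟩

end LaurentRing

/-! ### The group structure of the total Alexander quandle -/

namespace VirtualLinkDiagram

open LaurentRing

variable {μ : ℕ} (D : VirtualLinkDiagram μ)

/-- The set `U(L)`, regarded as a group under `x * y = x + (φ(x) + 1) y`. -/
def TotalGroup := {x : D.AlexanderModule // IsUnit (D.phi x + 1)}

namespace TotalGroup

variable {D}

theorem phi_mul_add_one (x y : D.AlexanderModule) :
    D.phi (x + (D.phi x + 1) • y) + 1 = (D.phi x + 1) * (D.phi y + 1) := by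
  rw [map_add, map_smul, smul_eq_mul]
  ring

instance : Group D.TotalGroup where
  mul x y := ⟨x.1 + (D.phi x.1 + 1) • y.1, by rw [phi_mul_add_one]; exact x.2.mul y.2⟩
  one := ⟨0, by rw [map_zero, zero_add]; exact isUnit_one⟩
  inv x := ⟨-((↑x.2.unit⁻¹ : LaurentRing μ) • x.1), by
    -- With $u=\phi(x)+1$ this is $1-u^{-1}(u-1)=u^{-1}$.
    have h : D.phi (-((↑x.2.unit⁻¹ : LaurentRing μ) • x.1)) + 1 = ↑x.2.unit⁻¹ := by
      have h : (↑x.2.unit⁻¹ : LaurentRing μ) * (D.phi x.1 + 1) = 1 := x.2.val_inv_mul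
      rw [map_neg, map_smul, smul_eq_mul]
      linear_combination -h
    rw [h]
    exact Units.isUnit _⟩
  mul_assoc x y z := Subtype.ext <| by
    change (x.1 + (D.phi x.1 + 1) • y.1) + (D.phi (x.1 + (D.phi x.1 + 1) • y.1) + 1) • z.1 =
      x.1 + (D.phi x.1 + 1) • (y.1 + (D.phi y.1 + 1) • z.1)
    rw [phi_mul_add_one]
    module
  one_mul x := Subtype.ext <| by
    change 0 + (D.phi 0 + 1) • x.1 = x.1
    simp
  mul_one x := Subtype.ext <| by
    change x.1 + (D.phi x.1 + 1) • (0 : D.AlexanderModule) = x.1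
    simp
  inv_mul_cancel x := Subtype.ext <| by
    change -((↑x.2.unit⁻¹ : LaurentRing μ) • x.1) +
      (D.phi (-((↑x.2.unit⁻¹ : LaurentRing μ) • x.1)) + 1) • x.1 = 0
    have h : D.phi (-((↑x.2.unit⁻¹ : LaurentRing μ) • x.1)) + 1 = ↑x.2.unit⁻¹ := by
      have h : (↑x.2.unit⁻¹ : LaurentRing μ) * (D.phi x.1 + 1) = 1 := x.2.val_inv_mul
      rw [map_neg, map_smul, smul_eq_mul]
      linear_combination -h
    rw [h]
    abel

theorem val_one : (1 : D.TotalGroup).1 = 0 := rfl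

theorem val_mul (x y : D.TotalGroup) : (x * y).1 = x.1 + (D.phi x.1 + 1) • y.1 := rfl

/-- The homomorphism `x ↦ φ(x) + 1` to the multiplicative monoid of `Λ_μ`. -/
def unitHom : D.TotalGroup →* LaurentRing μ where
  toFun x := D.phi x.1 + 1
  map_one' := by rw [val_one, map_zero, zero_add]
  map_mul' x y := phi_mul_add_one x.1 y.1

theorem unitHom_apply (x : D.TotalGroup) : unitHom x = D.phi x.1 + 1 := rfl

/-- An element of the quandle `U(L)`, regarded as an element of the group `U(L)`. -/
def ofQuandle : D.TotalQuandle ≃ D.TotalGroup := Equiv.refl _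

/-- The quandle operation of `U(L)` is conjugation in the group `U(L)`. -/
theorem ofQuandle_act (x y : D.TotalQuandle) :
    ofQuandle (y ◃ x) = ofQuandle y * ofQuandle x * (ofQuandle y)⁻¹ := by
  -- Clearing the inverse leaves $(x\triangleright y)*y=y*x$, where $\phi(x\triangleright
  -- y)=\phi(x)$.
  refine eq_mul_inv_of_mul_eq (Subtype.ext ?_)
  have h : ((D.phi y.1 + 1) • x.1 - D.phi x.1 • y.1) +
      (D.phi ((D.phi y.1 + 1) • x.1 - D.phi x.1 • y.1) + 1) • y.1 =
        y.1 + (D.phi y.1 + 1) • x.1 := by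
    rw [phi_act]
    module
  exact h

end TotalGroup

/-! ### The degree and the Fox map -/

/-- The relations of the link group hold for an assignment of group elements to the arcs. -/
theorem lift_groupRels {G : Type*} [Group G] (f : D.Arc → G)
    (hf : ∀ c, f (D.overArc c) * f (D.rightArc c) = f (D.leftArc c) * f (D.overArc c)) :
    ∀ r ∈ D.groupRels, FreeGroup.lift f r = 1 := by
  rintro _ ⟨c, rfl⟩
  simp only [map_mul, map_inv, FreeGroup.lift_apply_of]
  rw [hf c]
  group

/-- The homomorphism from the link group to `ℤ^μ` that sends `g_a` to the basis vector with
index `κ(a)`. -/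
def degree : D.LinkGroup →* Multiplicative (Fin μ →₀ ℤ) :=
  PresentedGroup.toGroup (f := fun a => Multiplicative.ofAdd (Finsupp.single (D.component a) 1))
    (D.lift_groupRels _ fun c => by rw [D.component_rightArc c, mul_comm])

theorem degree_of (a : D.Arc) : D.degree (PresentedGroup.of a) =
    Multiplicative.ofAdd (Finsupp.single (D.component a) 1) :=
  PresentedGroup.toGroup.of _

/-- The defining relation of the Alexander module. -/
theorem gamma_relation (c : D.Crossing) :
    (1 - t (D.component (D.rightArc c))) • D.gamma (D.overArc c) +
      t (D.component (D.overArc c)) • D.gamma (D.rightArc c) = D.gamma (D.leftArc c) := by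
  rw [← sub_eq_zero]
  simp only [gamma, ← Submodule.Quotient.mk_smul, ← Submodule.Quotient.mk_add,
    ← Submodule.Quotient.mk_sub]
  rw [Submodule.Quotient.mk_eq_zero]
  refine ⟨Finsupp.single c 1, ?_⟩
  simp [rho]

/-- `γ_D(a)` as an element of the group `U(L)`. -/
def gammaG (a : D.Arc) : D.TotalGroup := TotalGroup.ofQuandle (D.gammaU a)

/-- The homomorphism from the link group to the group `U(L)` that sends `g_a` to `γ_D(a)`. -/
def fox : D.LinkGroup →* D.TotalGroup :=
  PresentedGroup.toGroup (f := D.gammaG) (D.lift_groupRels D.gammaG fun c => Subtype.ext <| by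
    -- The identity $a*b_1=b_2*a$ is the Alexander relation at the crossing, because $b_1$ and $b_2$
    -- lie on the same component.
    rw [TotalGroup.val_mul, TotalGroup.val_mul]
    change D.gamma _ + (D.phi (D.gamma _) + 1) • D.gamma _ =
      D.gamma _ + (D.phi (D.gamma _) + 1) • D.gamma _
    rw [phi_gamma, phi_gamma, ← D.gamma_relation c, D.component_rightArc c]
    module)

theorem fox_of (a : D.Arc) : D.fox (PresentedGroup.of a) = D.gammaG a :=
  PresentedGroup.toGroup.of _

theorem fox_of_val (a : D.Arc) : (D.fox (PresentedGroup.of a)).1 = D.gamma a := by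
  rw [fox_of]
  rfl

/-- The monomial of `Λ_μ` that corresponds to the degree of an element of the link group. -/
abbrev mono (g : D.LinkGroup) : LaurentRing μ := AddMonoidAlgebra.single (D.degree g).toAdd 1

theorem phi_fox (g : D.LinkGroup) : D.phi (D.fox g).1 + 1 = D.mono g := by
  have h : TotalGroup.unitHom.comp D.fox =
      (AddMonoidAlgebra.of ℤ (Fin μ →₀ ℤ)).comp D.degree := by
    refine MonoidHom.eq_of_eqOn_dense (PresentedGroup.closure_range_of D.groupRels) ?_
    rintro _ ⟨a, rfl⟩
    rw [MonoidHom.comp_apply, MonoidHom.comp_apply, TotalGroup.unitHom_apply, fox_of_val,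
      phi_gamma, sub_add_cancel, degree_of]
    rfl
  exact DFunLike.congr_fun h g

/-- The product rule of Fox calculus: `fox` is a crossed homomorphism over the degree. -/
theorem fox_mul_val (g g' : D.LinkGroup) :
    (D.fox (g * g')).1 = (D.fox g).1 + D.mono g • (D.fox g').1 := by
  rw [map_mul, TotalGroup.val_mul, phi_fox]

theorem fox_one_val : (D.fox 1).1 = 0 := by rw [map_one, TotalGroup.val_one]

end VirtualLinkDiagram

namespace VirtualLinkDiagram

variable {μ : ℕ} (D : VirtualLinkDiagram μ)

/-! ### The arcs of a component and the abelianization of the link group -/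

theorem exists_arc_of_component (i : Fin μ) : ∃ a, D.component a = i :=
  ⟨D.arcAfter (i, 0), D.component_arcAfter _⟩

theorem eq_of_germOn {l : Filter ℝ} [l.NeBot] {p : Circles μ} {a b : D.Arc} {S : Set ℝ}
    (hS : S ∈ l) (ha : D.GermOn l p a)
    (hb : ∀ s ∈ S, ∃ h : (p.1, p.2 + (s : UnitAddCircle)) ∉ D.underPoints,
      (ConnectedComponents.mk ⟨_, h⟩ : D.Arc) = b) : a = b := by
  obtain ⟨s, ⟨_, h1⟩, hs⟩ := (ha.and hS).exists
  obtain ⟨_, h2⟩ := hb s hs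
  exact h1.symm.trans h2

/-- At a point that is not underpassing, the incoming and the outgoing arc are the arc through the
point. -/
theorem arc_eq_of_not_mem (p : Circles μ) (hp : p ∉ D.underPoints) :
    D.arcBefore p = ConnectedComponents.mk ⟨p, hp⟩ ∧
      D.arcAfter p = ConnectedComponents.mk ⟨p, hp⟩ := by
  obtain ⟨ε, hε, h⟩ := D.exists_radius p
  have h' : ∀ s ∈ Set.Ioo (-ε) ε, (p.1, p.2 + (s : UnitAddCircle)) ∉ D.underPoints := by
    intro s hs
    by_cases hs0 : s = 0
    · subst hs0
      simpa using hp
    · exact h s hs0 (abs_lt.2 hs)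
  obtain ⟨a, ha⟩ := D.exists_arc_of_Ioo p (by linarith) h'
  have h0 : ConnectedComponents.mk ⟨p, hp⟩ = a := by
    rw [← ha 0 ⟨by linarith, hε⟩]
    congr 2
    simp
  have hn : Set.Ioo (-ε) ε ∈ 𝓝 (0 : ℝ) := Ioo_mem_nhds (by linarith) hε
  rw [h0]
  exact ⟨D.eq_of_germOn (nhdsWithin_le_nhds hn) (D.exists_arcBefore p).choose_spec
      fun s hs => ⟨h' s hs, ha s hs⟩,
    D.eq_of_germOn (nhdsWithin_le_nhds hn) (D.exists_arcAfter p).choose_spec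
      fun s hs => ⟨h' s hs, ha s hs⟩⟩

/-- A function of the arcs that does not change at the crossings depends only on the component of
the arc. -/
theorem eq_of_component_eq {T : Type*} (f : D.Arc → T)
    (hf : ∀ c, f (D.rightArc c) = f (D.leftArc c)) {a b : D.Arc}
    (hab : D.component a = D.component b) : f a = f b := by
  -- At an underpassing point the incoming and outgoing arcs are $b_1$ and $b_2$ in some order.
  have hBA : ∀ p, f (D.arcBefore p) = f (D.arcAfter p) := by
    intro p
    by_cases hp : p ∈ D.underPoints
    · obtain ⟨c, hc, rfl⟩ := hp
      have := hf ⟨c, hc⟩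
      unfold rightArc leftArc at this
      split_ifs at this
      · exact this
      · exact this.symm
    · rw [(D.arc_eq_of_not_mem p hp).1, (D.arc_eq_of_not_mem p hp).2]
  -- Taking the incoming arc extends `f` over the underpassing points, so that local constancy along
  -- whole circles makes sense.
  let F : Circles μ → T := fun p => f (D.arcBefore p)
  have hF : ∀ q (hq : q ∉ D.underPoints), F q = f (ConnectedComponents.mk ⟨q, hq⟩) :=
    fun q hq => congrArg f (D.arc_eq_of_not_mem q hq).1
  have hloc : ∀ p : Circles μ, ∀ᶠ s : ℝ in 𝓝 0, F (p.1, p.2 + (s : UnitAddCircle)) = F p := by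
    intro p
    rw [← nhdsNE_sup_pure, ← nhdsLT_sup_nhdsGT, Filter.eventually_sup, Filter.eventually_sup,
      Filter.eventually_pure]
    refine ⟨⟨?_, ?_⟩, by simp⟩
    · filter_upwards [(D.exists_arcBefore p).choose_spec] with s ⟨hs, h⟩
      rw [hF _ hs, h]
      rfl
    · filter_upwards [(D.exists_arcAfter p).choose_spec] with s ⟨hs, h⟩
      rw [hF _ hs, h]
      exact (hBA p).symm
  -- Each circle is covered by the connected real line.
  have hconst : ∀ i, IsLocallyConstant fun s : ℝ => F (i, (s : UnitAddCircle)) := by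
    intro i
    rw [IsLocallyConstant.iff_eventually_eq]
    intro x
    have h1 : Filter.Tendsto (fun y : ℝ => y - x) (𝓝 x) (𝓝 0) :=
      Continuous.tendsto' (by fun_prop) _ _ (sub_self x)
    filter_upwards [h1.eventually (hloc (i, (x : UnitAddCircle)))] with y hy
    simpa using hy
  obtain ⟨⟨⟨i, x⟩, hp⟩, rfl⟩ := ConnectedComponents.surjective_coe a
  obtain ⟨⟨⟨j, y⟩, hq⟩, rfl⟩ := ConnectedComponents.surjective_coe b
  obtain rfl : i = j := hab
  obtain ⟨x, rfl⟩ := QuotientAddGroup.mk_surjective x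
  obtain ⟨y, rfl⟩ := QuotientAddGroup.mk_surjective y
  have h := (hconst i).apply_eq_of_preconnectedSpace x y
  exact (hF _ hp).symm.trans (h.trans (hF _ hq))

theorem degree_surjective : Function.Surjective D.degree := by
  rw [← MonoidHom.range_eq_top, ← top_le_iff]
  intro h _
  obtain ⟨h, rfl⟩ := Multiplicative.ofAdd.surjective h
  induction h using Finsupp.induction_linear with
  | zero => exact one_mem _
  | add x y hx hy => exact mul_mem (hx trivial) (hy trivial)
  | single i n =>
    obtain ⟨a, rfl⟩ := D.exists_arc_of_component i
    refine ⟨PresentedGroup.of a ^ n, ?_⟩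
    rw [map_zpow, degree_of, ← ofAdd_zsmul]
    simp

/-- A homomorphism to an abelian group factors through the degree. -/
theorem map_eq_one_of_degree_eq_one {B : Type*} [CommGroup B] (f : D.LinkGroup →* B)
    {g : D.LinkGroup} (hg : D.degree g = 1) : f g = 1 := by
  choose arc harc using D.exists_arc_of_component
  let j : Multiplicative (Fin μ →₀ ℤ) →* B := AddMonoidHom.toMultiplicativeLeft
    (Finsupp.liftAddHom fun i => zmultiplesHom (Additive B)
      (Additive.ofMul (f (PresentedGroup.of (arc i)))))
  have h : f = j.comp D.degree := by
    refine PresentedGroup.ext fun a => ?_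
    rw [MonoidHom.comp_apply, degree_of]
    -- In an abelian group the crossing relation says that $g_{b_1}$ and $g_{b_2}$ have the same
    -- image.
    have h1 : f (PresentedGroup.of a) = f (PresentedGroup.of (arc (D.component a))) := by
      refine D.eq_of_component_eq (fun a => f (PresentedGroup.of a)) (fun c => ?_) (harc _).symm
      have h2 := congrArg f (D.group_relation c)
      rw [map_mul, map_mul, map_inv, mul_right_comm, mul_inv_cancel, one_mul] at h2
      exact h2
    rw [h1]
    simp [j]
  rw [h, MonoidHom.comp_apply, hg, map_one]

theorem ker_degree : D.degree.ker = commutator D.LinkGroup := by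
  refine le_antisymm (fun g hg => ?_) (Abelianization.commutator_subset_ker _)
  rw [← Abelianization.ker_of, MonoidHom.mem_ker]
  exact D.map_eq_one_of_degree_eq_one _ hg

/-- Since the kernel of the degree is $G'$, its abelianization is $G'/G''$, the target of the
Schreier elements. -/
theorem map_commutator_ker_degree :
    (commutator D.degree.ker).map D.degree.ker.subtype = derivedSeries D.LinkGroup 2 := by
  rw [Subgroup.map_subtype_commutator, ker_degree]
  rfl

end VirtualLinkDiagram

namespace VirtualLinkDiagram

open AddMonoidAlgebra LaurentRing

variable {μ : ℕ} (D : VirtualLinkDiagram μ)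

/-! ### The kernel of the Fox map -/

/-- An element of the link group with a given degree. -/
def degreeSection (h : Fin μ →₀ ℤ) : D.LinkGroup :=
  (D.degree_surjective (Multiplicative.ofAdd h)).choose

theorem degree_degreeSection (h : Fin μ →₀ ℤ) :
    D.degree (D.degreeSection h) = Multiplicative.ofAdd h :=
  (D.degree_surjective (Multiplicative.ofAdd h)).choose_spec

theorem schreier_mem (h : Fin μ →₀ ℤ) (g : D.LinkGroup) :
    D.degreeSection h * g * (D.degreeSection (h + (D.degree g).toAdd))⁻¹ ∈ D.degree.ker := by
  rw [MonoidHom.mem_ker, map_mul, map_mul, map_inv, degree_degreeSection, degree_degreeSection,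
    ofAdd_add, ofAdd_toAdd, mul_inv_cancel]

/-- The Schreier element `s(h) g s(h + deg g)⁻¹` of the kernel of the degree, up to commutators of
the kernel. -/
def schreier (h : Fin μ →₀ ℤ) (g : D.LinkGroup) : Additive (Abelianization D.degree.ker) :=
  Additive.ofMul (Abelianization.of ⟨_, D.schreier_mem h g⟩)

/-- The inner factors $s(h+\deg g)^{\mp1}$ telescope. This is the product rule of `fox` multiplied
by $t^h$. -/
theorem schreier_mul (h : Fin μ →₀ ℤ) (g g' : D.LinkGroup) :
    D.schreier h (g * g') = D.schreier h g + D.schreier (h + (D.degree g).toAdd) g' := by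
  rw [schreier, schreier, schreier, ← ofMul_mul, ← map_mul]
  congr 2
  apply Subtype.ext
  simp only [Subgroup.coe_mul, map_mul, toAdd_mul, add_assoc]
  group

theorem schreier_one (h : Fin μ →₀ ℤ) : D.schreier h 1 = 0 := by
  have h1 := D.schreier_mul h 1 1
  simpa using h1

/-- Both sides expand the Schreier element of one group element, $g_ag_{b_1}=g_{b_2}g_a$. -/
theorem schreier_relation (h : Fin μ →₀ ℤ) (c : D.Crossing) :
    D.schreier h (PresentedGroup.of (D.overArc c)) +
      D.schreier (h + Finsupp.single (D.component (D.overArc c)) 1)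
        (PresentedGroup.of (D.rightArc c)) =
    D.schreier h (PresentedGroup.of (D.leftArc c)) +
      D.schreier (h + Finsupp.single (D.component (D.rightArc c)) 1)
        (PresentedGroup.of (D.overArc c)) := by
  have h1 := D.schreier_mul h (PresentedGroup.of (D.overArc c)) (PresentedGroup.of (D.rightArc c))
  have h2 := D.schreier_mul h (PresentedGroup.of (D.leftArc c)) (PresentedGroup.of (D.overArc c))
  rw [degree_of, toAdd_ofAdd] at h1 h2
  rw [D.component_rightArc, ← h1, ← h2, ← D.group_relation c, inv_mul_cancel_right]

/-- The additive map on the free module on the arcs that sends `t^h a` to the Schreier element of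
`h` and `g_a`. -/
def foxInvAux : (D.Arc →₀ LaurentRing μ) →+ Additive (Abelianization D.degree.ker) :=
  Finsupp.liftAddHom fun a => monomialLift fun h => D.schreier h (PresentedGroup.of a)

theorem foxInvAux_single (a : D.Arc) (h : Fin μ →₀ ℤ) :
    D.foxInvAux (Finsupp.single a (single h 1)) = D.schreier h (PresentedGroup.of a) := by
  rw [foxInvAux, Finsupp.liftAddHom_apply_single, monomialLift_single, one_smul]

/-- The map is only additive, so it is tested on every $t^hc$; there it reduces to
`schreier_relation`. -/
theorem foxInvAux_rho (x : D.Crossing →₀ LaurentRing μ) : D.foxInvAux (D.rho x) = 0 := by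
  have h : D.foxInvAux.comp D.rho.toAddMonoidHom = 0 := by
    refine Finsupp.addHom_ext' fun c => addMonoidHom_ext_monomial fun h => ?_
    have h1 : D.rho (Finsupp.single c (single h 1)) =
        Finsupp.single (D.overArc c) (single h 1) -
          Finsupp.single (D.overArc c)
            (single (h + Finsupp.single (D.component (D.rightArc c)) 1) 1) +
          Finsupp.single (D.rightArc c)
            (single (h + Finsupp.single (D.component (D.overArc c)) 1) 1) -
          Finsupp.single (D.leftArc c) (single h 1) := by
      rw [rho, Finsupp.linearCombination_single]
      simp only [smul_add, smul_sub, Finsupp.smul_single, smul_eq_mul, mul_one, t,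
        single_mul_single, Finsupp.single_sub]
    change D.foxInvAux (D.rho (Finsupp.single c (single h 1))) = 0
    rw [h1, map_sub, map_add, map_sub, foxInvAux_single, foxInvAux_single, foxInvAux_single,
      foxInvAux_single, sub_add_eq_add_sub, schreier_relation, add_sub_cancel_right, sub_self]
  exact DFunLike.congr_fun h x

/-- The additive map on the Alexander module that sends `t^h γ_D(a)` to the Schreier element of `h`
and `g_a`. -/
def foxInv : D.AlexanderModule →+ Additive (Abelianization D.degree.ker) :=
  QuotientAddGroup.lift (LinearMap.range D.rho).toAddSubgroup D.foxInvAux (by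
    rintro _ ⟨x, rfl⟩
    exact D.foxInvAux_rho x)

theorem foxInv_gamma (h : Fin μ →₀ ℤ) (a : D.Arc) :
    D.foxInv ((single h 1 : LaurentRing μ) • D.gamma a) =
      D.schreier h (PresentedGroup.of a) := by
  rw [gamma, ← Submodule.Quotient.mk_smul, Finsupp.smul_single, smul_eq_mul, mul_one]
  exact D.foxInvAux_single a h

theorem single_smul_fox_mul (h : Fin μ →₀ ℤ) (g g' : D.LinkGroup) :
    (single h 1 : LaurentRing μ) • (D.fox (g * g')).1 =
      (single h 1 : LaurentRing μ) • (D.fox g).1 +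
        (single (h + (D.degree g).toAdd) 1 : LaurentRing μ) • (D.fox g').1 := by
  rw [fox_mul_val, smul_add, smul_smul, single_mul_single, one_mul]

/-- Both sides satisfy the same product rule and agree on generators. The rule shifts $h$, hence the
induction runs over all $h$ at once. -/
theorem foxInv_fox (g : D.LinkGroup) : ∀ h : Fin μ →₀ ℤ,
    D.foxInv ((single h 1 : LaurentRing μ) • (D.fox g).1) = D.schreier h g := by
  have hg : g ∈ Subgroup.closure (Set.range (PresentedGroup.of (rels := D.groupRels))) := by
    rw [PresentedGroup.closure_range_of]
    trivial
  induction hg using Subgroup.closure_induction with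
  | mem x hx =>
    obtain ⟨a, rfl⟩ := hx
    intro h
    rw [fox_of_val, foxInv_gamma]
  | one =>
    intro h
    rw [fox_one_val, smul_zero, map_zero, schreier_one]
  | mul x y _ _ hx hy =>
    intro h
    rw [single_smul_fox_mul, map_add, hx, hy, schreier_mul]
  | inv x _ hx =>
    intro h
    have h1 := D.single_smul_fox_mul h x⁻¹ x
    have h2 := D.schreier_mul h x⁻¹ x
    rw [inv_mul_cancel, fox_one_val, smul_zero] at h1
    rw [inv_mul_cancel, schreier_one] at h2
    have h3 := congrArg D.foxInv h1
    rw [map_zero, map_add, hx] at h3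
    exact add_right_cancel (h3.symm.trans h2)

theorem degree_eq_one_of_phi_eq_zero {g : D.LinkGroup} (hg : D.phi (D.fox g).1 = 0) :
    D.degree g = 1 := by
  have h := D.phi_fox g
  rw [hg, zero_add, one_def] at h
  exact ((single_left_inj one_ne_zero).1 h).symm

theorem ker_fox : D.fox.ker = derivedSeries D.LinkGroup 2 := by
  refine le_antisymm (fun g hg => ?_) ?_
  · have h0 : (D.fox g).1 = 0 := by
      rw [MonoidHom.mem_ker.1 hg]
      rfl
    have hdeg : D.degree g = 1 := D.degree_eq_one_of_phi_eq_zero (by rw [h0, map_zero])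
    have h1 := D.foxInv_fox g 0
    rw [h0, smul_zero, map_zero] at h1
    have h2 : (⟨_, D.schreier_mem 0 g⟩ : D.degree.ker) ∈ commutator D.degree.ker := by
      rw [← Abelianization.ker_of]
      exact congrArg Additive.toMul h1.symm
    have h3 := Subgroup.mem_map_of_mem D.degree.ker.subtype h2
    rw [map_commutator_ker_degree] at h3
    -- The section need not send 0 to 1, so only a conjugate of $g$ is obtained; normality of $G''$
    -- removes the conjugation.
    have h4 : D.degreeSection 0 * g * (D.degreeSection 0)⁻¹ ∈ derivedSeries D.LinkGroup 2 := by
      simpa [hdeg] using h3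
    have h5 := (derivedSeries_normal D.LinkGroup 2).conj_mem _ h4 (D.degreeSection 0)⁻¹
    simpa [mul_assoc] using h5
  · rw [← map_commutator_ker_degree, Subgroup.map_le_iff_le_comap, commutator_def,
      Subgroup.commutator_le]
    rintro ⟨x, hx⟩ - ⟨y, hy⟩ -
    rw [Subgroup.mem_comap, MonoidHom.mem_ker, map_commutatorElement, map_commutatorElement,
      commutatorElement_eq_one_iff_mul_comm]
    apply Subtype.ext
    have hx' : D.mono x = 1 := by rw [mono, MonoidHom.mem_ker.1 hx]; rfl
    have hy' : D.mono y = 1 := by rw [mono, MonoidHom.mem_ker.1 hy]; rfl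
    change (D.fox x * D.fox y).1 = (D.fox y * D.fox x).1
    rw [← map_mul, ← map_mul, fox_mul_val, fox_mul_val, hx', hy', one_smul, one_smul, add_comm]

/-! ### The image of the Fox map -/

/-- The image under the Fox map of the kernel of the degree. -/
def foxKernelImage : AddSubgroup D.AlexanderModule where
  carrier := {x | ∃ g, D.degree g = 1 ∧ (D.fox g).1 = x}
  zero_mem' := ⟨1, map_one _, D.fox_one_val⟩
  add_mem' := by
    rintro _ _ ⟨g, hg, rfl⟩ ⟨g', hg', rfl⟩
    refine ⟨g * g', by rw [map_mul, hg, hg', one_mul], ?_⟩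
    rw [fox_mul_val, mono, hg, toAdd_one, ← one_def, one_smul]
  neg_mem' := by
    rintro _ ⟨g, hg, rfl⟩
    refine ⟨g⁻¹, by rw [map_inv, hg, inv_one], ?_⟩
    have h := D.fox_mul_val g g⁻¹
    rw [mul_inv_cancel, fox_one_val, mono, hg, toAdd_one, ← one_def, one_smul] at h
    exact (neg_eq_of_add_eq_zero_right h.symm).symm

/-- Makes the class in `crowellInv` independent of the chosen section. -/
theorem fox_sub_fox_mem {g g' : D.LinkGroup} (h : D.degree g = D.degree g') :
    (D.fox g).1 - (D.fox g').1 ∈ D.foxKernelImage := by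
  have h1 : D.degree (g * g'⁻¹) = 1 := by rw [map_mul, map_inv, h, mul_inv_cancel]
  refine ⟨g * g'⁻¹, h1, ?_⟩
  have h2 := D.fox_mul_val (g * g'⁻¹) g'
  rw [inv_mul_cancel_right, mono, h1, toAdd_one, ← one_def, one_smul] at h2
  rw [h2, add_sub_cancel_right]

/-- The additive map on `Λ_μ` that sends a monomial to the class of the Fox image of an element with
that degree. -/
def crowellInv : LaurentRing μ →+ D.AlexanderModule ⧸ D.foxKernelImage :=
  monomialLift fun h => QuotientAddGroup.mk (D.fox (D.degreeSection h)).1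

/-- Here $\phi(t^h\gamma_D(a))=t^{h+e}-t^h$ with $e$ the basis vector of $\kappa(a)$, while the
product rule gives $t^h\gamma_D(a)=fox(s(h)g_a)-fox(s(h))$; the elements $s(h)g_a$ and $s(h+e)$ have
equal degree. -/
theorem crowellInv_phi_gamma (a : D.Arc) (h : Fin μ →₀ ℤ) :
    D.crowellInv (D.phi ((single h 1 : LaurentRing μ) • D.gamma a)) =
      QuotientAddGroup.mk ((single h 1 : LaurentRing μ) • D.gamma a) := by
  rw [map_smul, phi_gamma, smul_eq_mul, mul_sub, mul_one, t, single_mul_single, one_mul, map_sub,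
    crowellInv, monomialLift_single, monomialLift_single, one_smul, one_smul,
    ← QuotientAddGroup.mk_sub, QuotientAddGroup.eq_iff_sub_mem]
  have h1 := D.fox_mul_val (D.degreeSection h) (PresentedGroup.of a)
  rw [fox_of_val, mono, degree_degreeSection, toAdd_ofAdd] at h1
  rw [sub_sub, ← h1]
  apply fox_sub_fox_mem
  rw [map_mul, degree_degreeSection, degree_degreeSection, degree_of, ofAdd_add]

/-- Exactness of the Crowell sequence at the Alexander module: if $\phi(x)=0$, then $x$ is a Fox
image of an element of degree 0. -/
theorem crowellInv_phi (x : D.AlexanderModule) :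
    D.crowellInv (D.phi x) = QuotientAddGroup.mk x := by
  obtain ⟨y, rfl⟩ := Submodule.Quotient.mk_surjective _ x
  have h : D.crowellInv.comp (D.phi.toAddMonoidHom.comp
        (LinearMap.range D.rho).mkQ.toAddMonoidHom) =
      (QuotientAddGroup.mk' D.foxKernelImage).comp
        (LinearMap.range D.rho).mkQ.toAddMonoidHom := by
    refine Finsupp.addHom_ext' fun a => addMonoidHom_ext_monomial fun h => ?_
    have h1 : (single h 1 : LaurentRing μ) • D.gamma a =
        (LinearMap.range D.rho).mkQ (Finsupp.single a (single h 1)) := by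
      rw [gamma, ← Submodule.mkQ_apply, ← map_smul, Finsupp.smul_single, smul_eq_mul, mul_one]
    have h2 := D.crowellInv_phi_gamma a h
    rw [h1] at h2
    exact h2
  exact DFunLike.congr_fun h y

theorem fox_surjective : Function.Surjective D.fox := by
  intro x
  obtain ⟨h, hh⟩ := exists_eq_monomial (f := D.phi x.1) (D.crowell x.1).2 x.2
  have hs : D.phi (D.fox (D.degreeSection h)).1 + 1 = D.phi x.1 + 1 := by
    rw [phi_fox, mono, degree_degreeSection, hh, toAdd_ofAdd]
  -- Dividing by a Fox image with the same value of $\phi+1$ moves $x$ into the kernel of $\phi$.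
  have h0 : D.phi (x * (D.fox (D.degreeSection h))⁻¹).1 = 0 := by
    have h1 : TotalGroup.unitHom (x * (D.fox (D.degreeSection h))⁻¹) = 1 := by
      have h2 : TotalGroup.unitHom (D.fox (D.degreeSection h)) = TotalGroup.unitHom x := hs
      rw [map_mul, ← h2, ← map_mul, mul_inv_cancel, map_one]
    rw [TotalGroup.unitHom_apply] at h1
    exact add_eq_right.1 h1
  have hmem := D.crowellInv_phi (x * (D.fox (D.degreeSection h))⁻¹).1
  rw [h0, map_zero] at hmem
  obtain ⟨g, -, hg⟩ := (QuotientAddGroup.eq_zero_iff _).1 hmem.symm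
  refine ⟨g * D.degreeSection h, ?_⟩
  rw [map_mul, show D.fox g = _ from Subtype.ext hg, inv_mul_cancel_right]

/-! ### The isomorphism -/

/-- The isomorphism from the group `U(L)` to `G(L)/G(L)''`. -/
def totalGroupEquiv : D.TotalGroup ≃* D.MetabelianQuotient :=
  ((QuotientGroup.quotientMulEquivOfEq D.ker_fox).symm.trans
    (QuotientGroup.quotientKerEquivOfSurjective D.fox D.fox_surjective)).symm

theorem totalGroupEquiv_fox (g : D.LinkGroup) : D.totalGroupEquiv (D.fox g) = QuotientGroup.mk g :=
  (MulEquiv.symm_apply_eq _).2 rfl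

/-- The isomorphism from the quandle `U(L)` to `Conj (G(L)/G(L)'')`. -/
def totalQuandleHom : D.TotalQuandle →◃ Quandle.Conj D.MetabelianQuotient where
  toFun x := D.totalGroupEquiv (TotalGroup.ofQuandle x)
  map_act' {x y} := by
    rw [TotalGroup.ofQuandle_act, map_mul, map_mul, map_inv, Quandle.conj_act_eq_conj]

theorem totalQuandleHom_gammaU (a : D.Arc) :
    D.totalQuandleHom (D.gammaU a) = D.toConjMetabelian (PresentedQuandle.of a) := by
  have h := D.totalGroupEquiv_fox (PresentedGroup.of a)
  rw [fox_of] at h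
  exact h

end VirtualLinkDiagram

/-! ### Matching the generated subquandle with the natural image -/

/-- A homomorphism of racks preserves the inverse operation. -/
theorem ShelfHom.map_invAct {R S : Type*} [Rack R] [Rack S] (f : R →◃ S) (x y : R) :
    f (x ◃⁻¹ y) = f x ◃⁻¹ f y := by
  rw [← Rack.left_cancel (f x), ← ShelfHom.map_act, Rack.act_invAct_eq, Rack.act_invAct_eq]

/-- Two homomorphisms that agree on the generators map the generated subquandle of the source of
one onto the image of the presented quandle under the other. -/
theorem QuandleClosure.image_eq_range {A R S : Type*} [Quandle R] [Quandle S]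
    {rels : QuandleWord A → QuandleWord A → Prop} (γ : A → R) (e : R →◃ S)
    (f : PresentedQuandle rels →◃ S) (h : ∀ a, e (γ a) = f (PresentedQuandle.of a)) :
    e '' {x | QuandleClosure (Set.range γ) x} = Set.range f := by
  apply Set.Subset.antisymm
  · rintro _ ⟨x, hx, rfl⟩
    induction hx with
    | mem hx =>
      obtain ⟨a, rfl⟩ := hx
      exact ⟨_, (h a).symm⟩
    | act _ _ hx hy =>
      obtain ⟨p, hp⟩ := hx
      obtain ⟨q, hq⟩ := hy
      exact ⟨p ◃ q, by rw [ShelfHom.map_act, ShelfHom.map_act, hp, hq]⟩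
    | invAct _ _ hx hy =>
      obtain ⟨p, hp⟩ := hx
      obtain ⟨q, hq⟩ := hy
      exact ⟨p ◃⁻¹ q, by rw [ShelfHom.map_invAct, ShelfHom.map_invAct, hp, hq]⟩
  · rintro _ ⟨⟨w⟩, rfl⟩
    -- A preimage in the generated subquandle is built along a word that represents the element.
    induction w with
    | of a => exact ⟨γ a, .mem ⟨a, rfl⟩, h a⟩
    | act x y hx hy =>
      obtain ⟨p, hp, hp'⟩ := hx
      obtain ⟨q, hq, hq'⟩ := hy
      refine ⟨p ◃ q, .act hp hq, ?_⟩
      rw [ShelfHom.map_act, hp', hq']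
      exact (ShelfHom.map_act f).symm
    | invAct x y hx hy =>
      obtain ⟨p, hp, hp'⟩ := hx
      obtain ⟨q, hq, hq'⟩ := hy
      refine ⟨p ◃⁻¹ q, .invAct hp hq, ?_⟩
      rw [ShelfHom.map_invAct, hp', hq']
      exact (ShelfHom.map_invAct f _ _).symm

end

theorem mainTheorem1 {μ : ℕ} (D : VirtualLinkDiagram μ) :
    ∃ e : D.TotalQuandle →◃ Quandle.Conj D.MetabelianQuotient,
      Function.Bijective e ∧ e '' D.fundamentalAlexanderQuandle = D.naturalImage :=
  ⟨D.totalQuandleHom, D.totalGroupEquiv.bijective.comp (Equiv.bijective _),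
    QuandleClosure.image_eq_range D.gammaU D.totalQuandleHom D.toConjMetabelian
      D.totalQuandleHom_gammaU⟩
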